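/- Work with (Lebesgue) measurable functions $f\colon(0,\infty)\to[-\infty,\infty]$, where $(0,\infty)$ carries Lebesgue measure. A function $A\colon[0,\infty]\to[0,\infty]$ is called \emph{quasi-convex} if it is left-continuous, is neither identically zero nor identically infinite on $(0,\infty]$, satisfies $A(0)=0$, and $t\mapsto A(t)/t$ is non-decreasing on $(0,\infty)$; it is a \emph{Young function} if, moreover, it is convex on $[0,\infty]$. For quasi-convex $A$, the Orlicz space $L^A$ is the set of all measurable $f$ such that $\int_0^\infty A(|f|/\lambda)\le 1$ for some $\lambda\in(0,\infty)$, with $\|f\|_{L^A}=\inf\{\lambda>0:\int_0^\infty A(|f|/\lambda)\le 1\}$. The weak Orlicz (Marcinkiewicz) space $M^A$ is the set of all measurable $f$ with \[ \|f\|_{M^A}=\sup_{0<t<\infty}\frac{f^{**}(t)}{A^{-1}(1/t)}<\infty , \] where $A^{-1}(s)=\sup\{\tau\ge 0: A(\tau)\le s\}$, $f^{**}(t)=\frac1t\int_0^t f^*(\tau)\,d\tau$ and $f^*(t)=\inf\{\lambda\ge 0: |\{|f|>\lambda\}|\le t\}$. Write $M^F\hookrightarrow L^B$ if there is a constant $C\in(0,\infty)$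 such that $\|f\|_{L^B}\le C\|f\|_{M^F}$ for every $f\in M^F$. \textbf{Theorem.} Let $F$ be a quasi-convex function. Then, as sets of functions, \[ M^F=\bigcap\bigl\{L^B:\ B \text{ is a Young function such that } M^F\hookrightarrow L^B\bigr\}. \] -/

import Mathlib

open MeasureTheory Set
open scoped ENNReal NNReal

namespace Orlicz

/-- Quasi-convex functions `A : [0,∞] → [0,∞]`: left-continuous, `A 0 = 0`, neither identically zero
nor identically infinite on `(0,∞]`, and such that `t ↦ A t / t` is non-decreasing on `(0,∞)`. -/
structure IsQuasiConvex (A : ℝ≥0∞ → ℝ≥0∞) : Prop where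
  map_zero : A 0 = 0
  left_cont : ∀ t, ContinuousWithinAt A (Iio t) t
  not_zero : ∃ t, 0 < t ∧ A t ≠ 0
  not_top : ∃ t, 0 < t ∧ A t ≠ ∞
  mono_div : MonotoneOn (fun t => A t / t) (Ioo 0 ∞)

/-- Young functions: quasi-convex functions which are convex on `[0,∞]`. -/
structure IsYoung (A : ℝ≥0∞ → ℝ≥0∞) : Prop extends IsQuasiConvex A where
  convex : ConvexOn ℝ≥0 univ A

/-- The right-continuous inverse `A⁻¹(t) = sup {τ ≥ 0 : A(τ) ≤ t}`. -/
noncomputable def rightInv (A : ℝ≥0∞ → ℝ≥0∞) (t : ℝ≥0∞) : ℝ≥0∞ :=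
  sSup {τ | A τ ≤ t}

/-- The correlative function `A_#(t) = 1 / A(1 / t)`, with `1 / 0 = ∞` and `1 / ∞ = 0`. -/
noncomputable def correlative (A : ℝ≥0∞ → ℝ≥0∞) (t : ℝ≥0∞) : ℝ≥0∞ :=
  (A t⁻¹)⁻¹

section Spaces

variable {Ω : Type*} [MeasurableSpace Ω]

/-- The distribution function `f_*(l) = μ {|f| > l}`. -/
noncomputable def distribution (μ : Measure Ω) (f : Ω → EReal) (l : ℝ≥0∞) : ℝ≥0∞ :=
  μ {x | l < (f x).abs}

/-- The non-increasing rearrangement `f^*(t) = inf {l ≥ 0 : f_*(l) ≤ t}`. -/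
noncomputable def rearrangement (μ : Measure Ω) (f : Ω → EReal) (t : ℝ≥0∞) : ℝ≥0∞ :=
  sInf {l | distribution μ f l ≤ t}

/-- The elementary maximal function `f^{**}(t) = (1 / t) ∫_0^t f^*(τ) dτ`, for `0 < t < ∞`. -/
noncomputable def maximalFn (μ : Measure Ω) (f : Ω → EReal) (t : ℝ) : ℝ≥0∞ :=
  (∫⁻ τ in Ioo (0 : ℝ) t, rearrangement μ f (ENNReal.ofReal τ)) / ENNReal.ofReal t

/-- The Orlicz semi-modular of the rescaled function: `ϱ_A(f / l) = ∫ A(|f| / l) dμ`. -/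
noncomputable def modular (μ : Measure Ω) (A : ℝ≥0∞ → ℝ≥0∞) (f : Ω → EReal) (l : ℝ≥0∞) : ℝ≥0∞ :=
  ∫⁻ x, A ((f x).abs / l) ∂μ

/-- The Orlicz space `L^A`. -/
def orliczSpace (μ : Measure Ω) (A : ℝ≥0∞ → ℝ≥0∞) : Set (Ω → EReal) :=
  {f | AEMeasurable f μ ∧ ∃ l, 0 < l ∧ l < ∞ ∧ modular μ A f l ≤ 1}

/-- The Luxemburg norm. -/
noncomputable def luxemburgNorm (μ : Measure Ω) (A : ℝ≥0∞ → ℝ≥0∞) (f : Ω → EReal) : ℝ≥0∞ :=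
  sInf {l | 0 < l ∧ l < ∞ ∧ modular μ A f l ≤ 1}

/-- The Marcinkiewicz norm: the supremum over `0 < t < ∞` of `A⁻¹_#(t) f^{**}(t)`, where `A⁻¹_#` is
the correlative function of the right-continuous inverse of `A`. -/
noncomputable def marcinkiewiczNorm (μ : Measure Ω) (A : ℝ≥0∞ → ℝ≥0∞) (f : Ω → EReal) : ℝ≥0∞ :=
  ⨆ t ∈ Ioi (0 : ℝ), correlative (rightInv A) (ENNReal.ofReal t) * maximalFn μ f t

/-- The weak Orlicz (Marcinkiewicz) space `M^A`. -/
def marcinkiewiczSpace (μ : Measure Ω) (A : ℝ≥0∞ → ℝ≥0∞) : Set (Ω → EReal) :=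
  {f | AEMeasurable f μ ∧ marcinkiewiczNorm μ A f < ∞}

/-- The embedding `M^A ↪ L^B`: for some constant `0 < C < ∞` one has `‖f‖_{L^B} ≤ C ‖f‖_{M^A}` for
every `f ∈ M^A`. -/
def MarcinkiewiczEmbedsOrlicz (μ : Measure Ω) (A B : ℝ≥0∞ → ℝ≥0∞) : Prop :=
  ∃ C : ℝ≥0, 0 < C ∧
    ∀ f ∈ marcinkiewiczSpace μ A, luxemburgNorm μ B f ≤ C * marcinkiewiczNorm μ A f

end Spaces

/-- Lebesgue measure on the half-line `(0,∞)`. -/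
noncomputable def halfLine : Measure (Ioi (0 : ℝ)) := Measure.comap Subtype.val volume

end Orlicz

/-! Write `a(t) = F⁻¹(1/t)`. The inclusion of `M^F` in every admissible `L^B` is immediate from the
norm inequality. Conversely, if `‖f‖_{M^F} = ∞`, choose `tₙ` with `f^{**}(tₙ) > 4ⁿ aₙ`, `aₙ =
a(tₙ)`, and condense them into one Young function `B(s) = ∑ 2^{-n-1} (s - aₙ)₊ / (tₙ aₙ)`.
Everything rests on comparing `∫ (|f| - aₙ l)₊` with `∫_0^{tₙ} f^* = tₙ f^{**}(tₙ)`. If `‖f‖_{M^F} ≤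
l`, then `f^*(tₙ) ≤ aₙ l`, so the excess is at most `tₙ aₙ l` and the weights sum to one: `M^F ↪
L^B` with constant 1 (`modular_levelYoung_le_one`). Conversely, modular at most 1 at scale `l`
forces `f^{**}(tₙ) ≤ (2^{n+1} + 1) aₙ l` (`maximalFn_le_of_modular_levelYoung_le_one`), which `4ⁿ`
eventually violates. -/

namespace Orlicz

/-! ### Rearrangements and truncated integrals. -/

section Rearrangement

variable {α β : Type*} [MeasurableSpace α] [MeasurableSpace β]

/-- The layer cake formula for truncations of extended nonnegative functions. -/
theorem lintegral_min_natCast_eq {μ : Measure α} {h : α → ℝ≥0∞} (hh : AEMeasurable h μ) (n : ℕ) :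
    ∫⁻ x, min (h x) n ∂μ =
      ∫⁻ l in Ioi (0 : ℝ), if ENNReal.ofReal l < n then μ {x | ENNReal.ofReal l < h x} else 0 := by
  have hfin : ∀ x, min (h x) (n : ℝ≥0∞) ≠ ∞ := fun x =>
    ((min_le_right _ _).trans_lt (ENNReal.natCast_lt_top n)).ne
  calc ∫⁻ x, min (h x) n ∂μ = ∫⁻ x, ENNReal.ofReal (min (h x) (n : ℝ≥0∞)).toReal ∂μ := by
        simp_rw [ENNReal.ofReal_toReal (hfin _)]
    _ = ∫⁻ l in Ioi (0 : ℝ), μ {x | l < (min (h x) (n : ℝ≥0∞)).toReal} :=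
        lintegral_eq_lintegral_meas_lt μ (Filter.Eventually.of_forall fun _ => ENNReal.toReal_nonneg)
          (hh.min aemeasurable_const).ennreal_toReal
    _ = _ := by
        refine setLIntegral_congr_fun measurableSet_Ioi fun l hl => ?_
        have hset : {x | l < (min (h x) (n : ℝ≥0∞)).toReal} =
            {x | ENNReal.ofReal l < h x ∧ ENNReal.ofReal l < n} := by
          ext x
          simp only [mem_ofPred_eq]
          rw [← ENNReal.ofReal_lt_iff_lt_toReal (le_of_lt hl) (hfin x), lt_min_iff]
        simp only [hset]
        split_ifs with hn <;> simp [hn]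

/-- Equimeasurable functions have the same integral. -/
theorem lintegral_eq_of_measure_lt_eq {μ : Measure α} {ν : Measure β} {h : α → ℝ≥0∞}
    {k : β → ℝ≥0∞} (hh : AEMeasurable h μ) (hk : AEMeasurable k ν)
    (hhk : ∀ l, μ {x | l < h x} = ν {y | l < k y}) : ∫⁻ x, h x ∂μ = ∫⁻ y, k y ∂ν := by
  have hsup : ∀ a : ℝ≥0∞, ⨆ n : ℕ, min a n = a := fun a => by
    rw [← inf_iSup_eq, ENNReal.iSup_natCast, inf_top_eq]
  have hmono : ∀ a : ℝ≥0∞, Monotone fun n : ℕ => min a (n : ℝ≥0∞) := fun a m n hmn =>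
    min_le_min_left _ (by exact_mod_cast hmn)
  calc ∫⁻ x, h x ∂μ = ⨆ n : ℕ, ∫⁻ x, min (h x) n ∂μ := by
        rw [← lintegral_iSup' (fun n => hh.min aemeasurable_const)
          (Filter.Eventually.of_forall fun x => hmono _)]
        simp_rw [hsup]
    _ = ⨆ n : ℕ, ∫⁻ y, min (k y) n ∂ν := by
        simp_rw [lintegral_min_natCast_eq hh, lintegral_min_natCast_eq hk, hhk]
    _ = ∫⁻ y, k y ∂ν := by
        rw [← lintegral_iSup' (fun n => hk.min aemeasurable_const)
          (Filter.Eventually.of_forall fun x => hmono _)]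
        simp_rw [hsup]

theorem measurable_abs : Measurable EReal.abs := by
  have habs : EReal.abs = fun x : EReal => max x.toENNReal (-x).toENNReal := by
    funext x
    induction x with
    | bot => simp
    | top => simp
    | coe x =>
      rw [EReal.abs_def, ← EReal.coe_neg, EReal.toENNReal_of_ne_top (EReal.coe_ne_top _),
        EReal.toENNReal_of_ne_top (EReal.coe_ne_top _), EReal.toReal_coe, EReal.toReal_coe,
        ← ENNReal.ofReal_max, abs_eq_max_neg]
  rw [habs]
  exact measurable_ereal_toENNReal.max (measurable_ereal_toENNReal.comp measurable_neg)

variable (μ : Measure α) (f : α → EReal)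

theorem distribution_antitone : Antitone (distribution μ f) := fun _ _ hlm =>
  measure_mono fun _ hx => lt_of_le_of_lt hlm hx

theorem rearrangement_antitone : Antitone (rearrangement μ f) := fun _ _ hst =>
  sInf_le_sInf fun _ hl => le_trans hl hst

/-- The nontrivial direction says that the infimum defining `f^*` is attained: the distribution
function is right-continuous, by continuity of the measure along increasing unions. -/
theorem rearrangement_le_iff {l t : ℝ≥0∞} : rearrangement μ f t ≤ l ↔ distribution μ f l ≤ t := by
  refine ⟨fun h => ?_, fun h => sInf_le h⟩
  rcases eq_or_ne l ∞ with rfl | hl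
  · simp [distribution]
  obtain ⟨u, hu, hmem, hlim⟩ := exists_seq_strictAnti_tendsto' hl.lt_top
  have hunion : {x | l < (f x).abs} = ⋃ n, {x | u n < (f x).abs} := by
    ext x
    simp only [mem_ofPred_eq, mem_iUnion]
    exact ⟨fun hx => (hlim.eventually_lt_const hx).exists,
      fun ⟨n, hn⟩ => (hmem n).1.trans hn⟩
  have hmono : Monotone fun n => {x | u n < (f x).abs} := fun m n hmn x hx =>
    lt_of_le_of_lt (hu.antitone hmn) hx
  rw [distribution, hunion, hmono.measure_iUnion]
  refine iSup_le fun n => ?_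
  obtain ⟨m, hm, hmu⟩ := sInf_lt_iff.1 (h.trans_lt (hmem n).1)
  exact (distribution_antitone μ f hmu.le).trans hm

theorem measurable_rearrangement_ofReal :
    Measurable fun τ : ℝ => rearrangement μ f (ENNReal.ofReal τ) :=
  Antitone.measurable fun _ _ hst => rearrangement_antitone μ f (ENNReal.ofReal_le_ofReal hst)

/-- A function and its rearrangement are equimeasurable. -/
theorem volume_lt_rearrangement (l : ℝ≥0∞) :
    (volume.restrict (Ioi (0 : ℝ))) {τ | l < rearrangement μ f (ENNReal.ofReal τ)} =
      distribution μ f l := by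
  have hset : {τ : ℝ | l < rearrangement μ f (ENNReal.ofReal τ)} ∩ Ioi 0 =
      {τ : ℝ | ENNReal.ofReal τ < distribution μ f l} ∩ Ioi 0 := by
    ext τ
    simp only [mem_inter_iff, mem_ofPred_eq]
    rw [← not_le, rearrangement_le_iff, not_le]
  rw [Measure.restrict_apply' measurableSet_Ioi, hset]
  rcases eq_or_ne (distribution μ f l) ∞ with hd | hd
  · simp [hd]
  · have : {τ : ℝ | ENNReal.ofReal τ < distribution μ f l} ∩ Ioi 0 =
        Ioo 0 (distribution μ f l).toReal := by
      ext τ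
      simp only [mem_inter_iff, mem_ofPred_eq, mem_Ioi, mem_Ioo]
      rw [and_comm]
      exact and_congr_right fun hτ => ENNReal.ofReal_lt_iff_lt_toReal hτ.le hd
    rw [this, Real.volume_Ioo, sub_zero, ENNReal.ofReal_toReal hd]

theorem lintegral_abs_sub_eq {μ : Measure α} {f : α → EReal} (hf : AEMeasurable f μ) (a : ℝ≥0∞) :
    ∫⁻ x, ((f x).abs - a) ∂μ =
      ∫⁻ τ in Ioi (0 : ℝ), (rearrangement μ f (ENNReal.ofReal τ) - a) := by
  refine lintegral_eq_of_measure_lt_eq ((measurable_abs.comp_aemeasurable hf).sub_const a)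
    ((measurable_rearrangement_ofReal μ f).sub_const a).aemeasurable fun l => ?_
  simp_rw [lt_tsub_iff_left]
  exact (volume_lt_rearrangement μ f (a + l)).symm

/-- If `f^*(t) ≤ a`, the part of `|f|` above the level `a` is controlled by `∫_0^t f^*`. -/
theorem lintegral_abs_sub_le {μ : Measure α} {f : α → EReal} (hf : AEMeasurable f μ) {a : ℝ≥0∞}
    {t : ℝ} (hta : rearrangement μ f (ENNReal.ofReal t) ≤ a) :
    ∫⁻ x, ((f x).abs - a) ∂μ ≤ ∫⁻ τ in Ioo (0 : ℝ) t, rearrangement μ f (ENNReal.ofReal τ) := by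
  rw [lintegral_abs_sub_eq hf, ← lintegral_indicator measurableSet_Ioi,
    ← lintegral_indicator measurableSet_Ioo]
  refine lintegral_mono fun τ => ?_
  rcases le_or_gt τ 0 with h0 | h0
  · simp [h0]
  rcases lt_or_ge τ t with h1 | h1
  · rw [indicator_of_mem (mem_Ioi.2 h0), indicator_of_mem (mem_Ioo.2 ⟨h0, h1⟩)]
    exact tsub_le_self
  · rw [indicator_of_mem (mem_Ioi.2 h0), tsub_eq_zero_of_le]
    · exact bot_le
    · exact (rearrangement_antitone μ f (ENNReal.ofReal_le_ofReal h1)).trans hta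

theorem setLIntegral_rearrangement_le {μ : Measure α} {f : α → EReal} (hf : AEMeasurable f μ)
    (a : ℝ≥0∞) (t : ℝ) :
    ∫⁻ τ in Ioo (0 : ℝ) t, rearrangement μ f (ENNReal.ofReal τ) ≤
      ∫⁻ x, ((f x).abs - a) ∂μ + a * ENNReal.ofReal t := by
  calc ∫⁻ τ in Ioo (0 : ℝ) t, rearrangement μ f (ENNReal.ofReal τ)
      ≤ ∫⁻ τ in Ioo (0 : ℝ) t, ((rearrangement μ f (ENNReal.ofReal τ) - a) + a) :=
        lintegral_mono fun τ => le_tsub_add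
    _ = (∫⁻ τ in Ioo (0 : ℝ) t, (rearrangement μ f (ENNReal.ofReal τ) - a)) +
          a * ENNReal.ofReal t := by
        rw [lintegral_add_right _ measurable_const, setLIntegral_const, Real.volume_Ioo, sub_zero]
    _ ≤ _ := by
        rw [lintegral_abs_sub_eq hf]
        gcongr
        exact Ioo_subset_Ioi_self

theorem rearrangement_le_maximalFn {t : ℝ} (ht : 0 < t) :
    rearrangement μ f (ENNReal.ofReal t) ≤ maximalFn μ f t := by
  rw [maximalFn, ENNReal.le_div_iff_mul_le (Or.inl (by simpa using ht)) (Or.inl ENNReal.ofReal_ne_top)]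
  calc rearrangement μ f (ENNReal.ofReal t) * ENNReal.ofReal t
      = ∫⁻ _ in Ioo (0 : ℝ) t, rearrangement μ f (ENNReal.ofReal t) := by
        rw [setLIntegral_const, Real.volume_Ioo, sub_zero]
    _ ≤ _ := setLIntegral_mono (measurable_rearrangement_ofReal μ f) fun τ hτ =>
        rearrangement_antitone μ f (ENNReal.ofReal_le_ofReal hτ.2.le)

end Rearrangement

/-! ### Quasi-convex functions and their inverses. -/

namespace IsQuasiConvex

variable {F : ℝ≥0∞ → ℝ≥0∞}

theorem map_mul_le (hF : IsQuasiConvex F) {s x : ℝ≥0∞} (hs : s ≤ 1) (hx : x ≠ ∞) :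
    F (s * x) ≤ s * F x := by
  rcases eq_or_ne s 0 with rfl | hs0
  · simp [hF.map_zero]
  rcases eq_or_ne x 0 with rfl | hx0
  · simp [hF.map_zero]
  have hst : s ≠ ∞ := (hs.trans_lt ENNReal.one_lt_top).ne
  have hsx0 : s * x ≠ 0 := mul_ne_zero hs0 hx0
  have hsx : s * x ≠ ∞ := ENNReal.mul_ne_top hst hx
  have h := hF.mono_div ⟨pos_iff_ne_zero.2 hsx0, hsx.lt_top⟩ ⟨pos_iff_ne_zero.2 hx0, hx.lt_top⟩
    (mul_le_of_le_one_left bot_le hs)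
  calc F (s * x) ≤ F x / x * (s * x) := (ENNReal.div_le_iff hsx0 hsx).1 h
    _ = s * (F x / x * x) := by ring
    _ = s * F x := by rw [ENNReal.div_mul_cancel hx0 hx]

/-- Monotonicity of `F(t)/t` gives at least linear growth beyond any finite point where `F` is
nonzero; left-continuity at `∞` supplies such a point and carries the growth to the limit. -/
theorem map_top (hF : IsQuasiConvex F) : F ∞ = ∞ := by
  have hlim : Filter.Tendsto F (nhdsWithin ∞ (Iio ∞)) (nhds (F ∞)) := hF.left_cont ∞
  have hne : (nhdsWithin ∞ (Iio (∞ : ℝ≥0∞))).NeBot := nhdsLT_neBot_of_exists_lt ⟨0, by simp⟩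
  obtain ⟨u, hu0, hut, hFu⟩ : ∃ u : ℝ≥0∞, u ≠ 0 ∧ u ≠ ∞ ∧ F u ≠ 0 := by
    by_contra! hzero
    have hfin : ∀ u : ℝ≥0∞, u ≠ ∞ → F u = 0 := fun u hu => by
      rcases eq_or_ne u 0 with rfl | h0
      · exact hF.map_zero
      · exact hzero u h0 hu
    obtain ⟨t, -, ht⟩ := hF.not_zero
    obtain rfl : t = ∞ := by
      by_contra h
      exact ht (hfin t h)
    refine ht (tendsto_nhds_unique hlim (tendsto_const_nhds.congr' ?_))
    filter_upwards [self_mem_nhdsWithin] with v hv using (hfin v (ne_of_lt hv)).symm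
  have hle : ∀ᶠ v in nhdsWithin ∞ (Iio (∞ : ℝ≥0∞)), F u / u * v ≤ F v := by
    filter_upwards [self_mem_nhdsWithin,
      mem_nhdsWithin_of_mem_nhds (Ioi_mem_nhds hut.lt_top)] with v hv huv
    have hv0 : v ≠ 0 := (bot_le.trans_lt huv).ne'
    exact (ENNReal.le_div_iff_mul_le (Or.inl hv0) (Or.inl hv.ne)).1 (hF.mono_div
      ⟨pos_iff_ne_zero.2 hu0, hut.lt_top⟩ ⟨pos_iff_ne_zero.2 hv0, hv⟩ (le_of_lt huv))
  have hlim' : Filter.Tendsto (fun v => F u / u * v) (nhdsWithin ∞ (Iio (∞ : ℝ≥0∞))) (nhds ∞) := by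
    have hc : F u / u ≠ 0 := by simp [ENNReal.div_eq_zero_iff, hFu, hut]
    have := ENNReal.Tendsto.const_mul (a := F u / u)
      ((Filter.tendsto_id (x := nhds (∞ : ℝ≥0∞))).mono_left
        (nhdsWithin_le_nhds (s := Iio (∞ : ℝ≥0∞)))) (Or.inl ENNReal.top_ne_zero)
    rwa [ENNReal.mul_top hc] at this
  exact top_le_iff.1 (le_of_tendsto_of_tendsto hlim' hlim hle)

theorem rightInv_ne_top (hF : IsQuasiConvex F) {s : ℝ≥0∞} (hs : s ≠ ∞) : rightInv F s ≠ ∞ := by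
  have hlim : Filter.Tendsto F (nhdsWithin ∞ (Iio ∞)) (nhds ∞) := by
    have := hF.left_cont ∞
    rwa [ContinuousWithinAt, hF.map_top] at this
  have hne : (nhdsWithin ∞ (Iio (∞ : ℝ≥0∞))).NeBot := nhdsLT_neBot_of_exists_lt ⟨0, by simp⟩
  have hlt : ∀ᶠ v in nhdsWithin ∞ (Iio (∞ : ℝ≥0∞)), v < ∞ := self_mem_nhdsWithin
  obtain ⟨u, hsu, hu⟩ := ((hlim.eventually_const_lt hs.lt_top).and hlt).exists
  refine ((sSup_le fun τ hτ => ?_).trans_lt hu).ne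
  by_contra! huτ
  have hτt : τ ≠ ∞ := by
    rintro rfl
    exact hs (top_le_iff.1 (hF.map_top ▸ hτ))
  have hτ0 : τ ≠ 0 := (bot_le.trans_lt huτ).ne'
  have h := hF.map_mul_le (s := u / τ) (ENNReal.div_le_of_le_mul (by simpa using huτ.le)) hτt
  rw [ENNReal.div_mul_cancel hτ0 hτt] at h
  have h1 : u / τ ≤ 1 := ENNReal.div_le_of_le_mul (by simpa using huτ.le)
  exact absurd (hsu.trans_le (h.trans (mul_le_of_le_one_left bot_le h1))) (not_lt.2 hτ)

theorem rightInv_ne_zero (hF : IsQuasiConvex F) {s : ℝ≥0∞} (hs : s ≠ 0) : rightInv F s ≠ 0 := by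
  obtain ⟨t, ht, hFt⟩ := hF.not_top
  have htt : t ≠ ∞ := by
    rintro rfl
    exact hFt hF.map_top
  -- Shrinking `t` by `c` gives `F (c * t) ≤ c * F t ≤ s`; the cap at 1 keeps `map_mul_le`
  -- applicable, including when `F t = 0`.
  set c := min 1 (s / F t) with hc
  have hc0 : c ≠ 0 := by
    rw [hc, ← pos_iff_ne_zero, lt_min_iff]
    exact ⟨zero_lt_one, ENNReal.div_pos hs hFt⟩
  have hmem : c * t ∈ {τ | F τ ≤ s} := by
    refine (hF.map_mul_le (min_le_left _ _) htt).trans ?_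
    calc c * F t ≤ s / F t * F t := by gcongr; exact min_le_right _ _
      _ ≤ s := ENNReal.mul_le_of_le_div le_rfl
  exact (pos_iff_ne_zero.2 (mul_ne_zero hc0 ht.ne')).trans_le (le_sSup hmem) |>.ne'

theorem mul_rightInv_le (hF : IsQuasiConvex F) {c s : ℝ≥0∞} (hc : c ≤ 1) (hs : s ≠ ∞) :
    c * rightInv F s ≤ rightInv F (c * s) := by
  rw [rightInv, ENNReal.mul_sSup]
  refine iSup₂_le fun τ hτ => le_sSup ?_
  have hτt : τ ≠ ∞ := by
    rintro rfl
    exact hs (top_le_iff.1 (hF.map_top ▸ hτ))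
  exact (hF.map_mul_le hc hτt).trans (mul_le_mul_right hτ _)

end IsQuasiConvex

theorem rightInv_mono (A : ℝ≥0∞ → ℝ≥0∞) : Monotone (rightInv A) := fun _ _ hst =>
  sSup_le_sSup fun _ hτ => le_trans hτ hst

/-! ### Young functions built from ramps. -/

/-- The series `∑ cₙ (s - aₙ)₊` of ramp functions. -/
noncomputable def rampSum (c a : ℕ → ℝ≥0∞) (s : ℝ≥0∞) : ℝ≥0∞ := ∑' n, c n * (s - a n)

theorem rampSum_mono (c a : ℕ → ℝ≥0∞) : Monotone (rampSum c a) := fun _ _ hst =>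
  ENNReal.tsum_le_tsum fun _ => mul_le_mul_right (tsub_le_tsub_right hst _) _

theorem lowerSemicontinuous_rampSum {c a : ℕ → ℝ≥0∞} (hc : ∀ n, c n ≠ ∞) :
    LowerSemicontinuous (rampSum c a) :=
  lowerSemicontinuous_tsum fun n => Continuous.lowerSemicontinuous
    ((ENNReal.continuous_const_mul (hc n)).comp (ENNReal.continuous_sub_right (a n)))

theorem isYoung_rampSum {c a : ℕ → ℝ≥0∞} (hc : ∀ n, c n ≠ ∞) (hc0 : c 0 ≠ 0) (ha : ∀ n, a n ≠ ∞)
    (hfin : ∃ s, 0 < s ∧ rampSum c a s ≠ ∞) : IsYoung (rampSum c a) where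
  map_zero := by simp [rampSum]
  left_cont t := by
    -- Left-continuity is lower semicontinuity from below and monotonicity from above; the series
    -- may jump to `∞`, so full continuity is not expected.
    refine tendsto_order.2 ⟨fun b hb => ?_, fun b hb => ?_⟩
    · exact nhdsWithin_le_nhds (lowerSemicontinuous_rampSum hc t b hb)
    · filter_upwards [self_mem_nhdsWithin] with s hs
      exact (rampSum_mono c a (le_of_lt hs)).trans_lt hb
  not_zero := by
    refine ⟨∞, ENNReal.zero_lt_top, fun h => ?_⟩
    have h0 := ENNReal.tsum_eq_zero.1 h 0
    simp [ENNReal.top_sub (ha 0), hc0] at h0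
  not_top := hfin
  mono_div s hs t ht hst := by
    have hdiv : ∀ u ∈ Ioo (0 : ℝ≥0∞) ∞, rampSum c a u / u = ∑' n, c n * (1 - a n / u) := by
      intro u hu
      simp_rw [rampSum, div_eq_mul_inv, ← ENNReal.tsum_mul_right, mul_assoc]
      refine tsum_congr fun n => ?_
      rw [ENNReal.sub_mul fun _ _ => ENNReal.inv_ne_top.2 hu.1.ne',
        ENNReal.mul_inv_cancel hu.1.ne' hu.2.ne]
    simp only
    rw [hdiv s hs, hdiv t ht]
    gcongr
  convex := by
    refine ⟨convex_univ, fun s _ t _ x y _ _ hxy => ?_⟩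
    simp only [ENNReal.smul_def, smul_eq_mul, rampSum]
    rw [← ENNReal.tsum_mul_left, ← ENNReal.tsum_mul_left, ← ENNReal.tsum_add]
    refine ENNReal.tsum_le_tsum fun n => ?_
    have hxy' : (x : ℝ≥0∞) + y = 1 := by exact_mod_cast hxy
    have hsub : (x * s + y * t : ℝ≥0∞) - a n ≤ x * (s - a n) + y * (t - a n) := by
      rw [tsub_le_iff_right]
      calc (x * s + y * t : ℝ≥0∞) ≤ x * (s - a n + a n) + y * (t - a n + a n) := by
            gcongr <;> exact le_tsub_add
        _ = x * (s - a n) + y * (t - a n) + (x + y) * a n := by ring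
        _ = _ := by rw [hxy', one_mul]
    calc c n * ((x * s + y * t : ℝ≥0∞) - a n) ≤ c n * (x * (s - a n) + y * (t - a n)) := by gcongr
      _ = _ := by ring

/-! ### The condensing Young function and its Orlicz space. -/

/-- The level `1 / φ(t) = A⁻¹(1 / t)`, where `φ` is the fundamental function of `M^A`. -/
noncomputable def level (A : ℝ≥0∞ → ℝ≥0∞) (t : ℝ) : ℝ≥0∞ := rightInv A (ENNReal.ofReal t)⁻¹

/-- The Young function `∑ 2^{-n-1} (s - aₙ)₊ / (tₙ aₙ)` with `aₙ = level A tₙ`. -/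
noncomputable def levelYoung (A : ℝ≥0∞ → ℝ≥0∞) (t : ℕ → ℝ) : ℝ≥0∞ → ℝ≥0∞ :=
  rampSum (fun n => 2⁻¹ ^ (n + 1) / (ENNReal.ofReal (t n) * level A (t n)))
    (fun n => level A (t n))

theorem tsum_two_inv_pow_succ : ∑' n : ℕ, (2⁻¹ : ℝ≥0∞) ^ (n + 1) = 1 := by
  simp_rw [pow_succ, ENNReal.tsum_mul_right, ENNReal.tsum_geometric, ENNReal.one_sub_inv_two,
    inv_inv]
  exact ENNReal.mul_inv_cancel two_ne_zero ENNReal.ofNat_ne_top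

section LevelYoung

variable {F : ℝ≥0∞ → ℝ≥0∞}

theorem level_ne_zero (hF : IsQuasiConvex F) (t : ℝ) : level F t ≠ 0 :=
  hF.rightInv_ne_zero (ENNReal.inv_ne_zero.2 ENNReal.ofReal_ne_top)

theorem level_ne_top (hF : IsQuasiConvex F) {t : ℝ} (ht : 0 < t) : level F t ≠ ∞ :=
  hF.rightInv_ne_top (ENNReal.inv_ne_top.2 (by simpa using ht))

theorem level_one_le_mul_level (hF : IsQuasiConvex F) {t : ℝ} (ht : 1 ≤ t) :
    level F 1 ≤ ENNReal.ofReal t * level F t := by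
  have ht0 : ENNReal.ofReal t ≠ 0 := by simpa using zero_lt_one.trans_le ht
  have h := hF.mul_rightInv_le (c := (ENNReal.ofReal t)⁻¹) (s := 1)
    (ENNReal.inv_le_one.2 (by simpa using ht)) ENNReal.one_ne_top
  rw [mul_one, ENNReal.inv_mul_le_iff ht0 ENNReal.ofReal_ne_top] at h
  simpa [level] using h

theorem level_antitone (A : ℝ≥0∞ → ℝ≥0∞) : Antitone (level A) := fun _ _ hst =>
  rightInv_mono A (ENNReal.inv_le_inv.2 (ENNReal.ofReal_le_ofReal hst))

/-- This makes the series finite at a positive point for any choice of `tₙ`. Ramps with `tₙ ≤ 1`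
vanish at `level F 1`; for `tₙ ≥ 1` quasi-convexity gives `level F 1 ≤ tₙ aₙ`, so each term is at
most its weight. -/
theorem levelYoung_level_one_le (hF : IsQuasiConvex F) (t : ℕ → ℝ) :
    levelYoung F t (level F 1) ≤ 1 := by
  rw [levelYoung, rampSum, ← tsum_two_inv_pow_succ]
  refine ENNReal.tsum_le_tsum fun n => ?_
  rcases le_total (t n) 1 with h | h
  · rw [tsub_eq_zero_of_le (level_antitone F h), mul_zero]
    exact bot_le
  · calc (2⁻¹ : ℝ≥0∞) ^ (n + 1) / (ENNReal.ofReal (t n) * level F (t n)) *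
          (level F 1 - level F (t n))
        ≤ (2⁻¹ : ℝ≥0∞) ^ (n + 1) / (ENNReal.ofReal (t n) * level F (t n)) *
          (ENNReal.ofReal (t n) * level F (t n)) := by
          gcongr
          exact tsub_le_self.trans (level_one_le_mul_level hF h)
      _ ≤ _ := ENNReal.mul_le_of_le_div le_rfl

theorem ofReal_mul_level_ne_zero (hF : IsQuasiConvex F) {t : ℝ} (ht : 0 < t) :
    ENNReal.ofReal t * level F t ≠ 0 :=
  mul_ne_zero (by simpa using ht) (level_ne_zero hF t)

theorem ofReal_mul_level_ne_top (hF : IsQuasiConvex F) {t : ℝ} (ht : 0 < t) :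
    ENNReal.ofReal t * level F t ≠ ∞ :=
  ENNReal.mul_ne_top ENNReal.ofReal_ne_top (level_ne_top hF ht)

theorem isYoung_levelYoung (hF : IsQuasiConvex F) {t : ℕ → ℝ} (ht : ∀ n, 0 < t n) :
    IsYoung (levelYoung F t) := by
  refine isYoung_rampSum (fun n => ?_) ?_ (fun n => level_ne_top hF (ht n))
    ⟨level F 1, pos_iff_ne_zero.2 (level_ne_zero hF 1),
      ((levelYoung_level_one_le hF t).trans_lt ENNReal.one_lt_top).ne⟩
  · exact ENNReal.div_ne_top (ENNReal.pow_ne_top (by simp)) (ofReal_mul_level_ne_zero hF (ht n))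
  · exact (ENNReal.div_pos (pow_ne_zero _ (by simp)) (ofReal_mul_level_ne_top hF (ht 0))).ne'

variable {α : Type*} [MeasurableSpace α] {μ : Measure α} {f : α → EReal}

theorem lintegral_abs_div_sub (hf : AEMeasurable f μ) (a : ℝ≥0∞) {l : ℝ≥0∞} (hl0 : l ≠ 0)
    (hl : l ≠ ∞) :
    ∫⁻ x, ((f x).abs / l - a) ∂μ = (∫⁻ x, ((f x).abs - a * l) ∂μ) / l := by
  have hmeas : AEMeasurable (fun x => (f x).abs - a * l) μ :=
    (measurable_abs.comp_aemeasurable hf).sub_const (a * l)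
  rw [div_eq_mul_inv, ← lintegral_mul_const'' _ hmeas]
  refine lintegral_congr fun x => ?_
  rw [ENNReal.sub_mul fun _ _ => ENNReal.inv_ne_top.2 hl0, mul_assoc,
    ENNReal.mul_inv_cancel hl0 hl, mul_one, div_eq_mul_inv]

theorem modular_rampSum (hf : AEMeasurable f μ) (c a : ℕ → ℝ≥0∞) {l : ℝ≥0∞} (hl0 : l ≠ 0)
    (hl : l ≠ ∞) :
    modular μ (rampSum c a) f l = ∑' n, c n * ((∫⁻ x, ((f x).abs - a n * l) ∂μ) / l) := by
  have hmeas : ∀ n, AEMeasurable (fun x => (f x).abs / l - a n) μ := fun n =>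
    ((measurable_abs.comp_aemeasurable hf).div_const l).sub_const (a n)
  simp only [modular, rampSum]
  rw [lintegral_tsum fun n => (hmeas n).const_mul (c n)]
  refine tsum_congr fun n => ?_
  rw [lintegral_const_mul'' _ (hmeas n), lintegral_abs_div_sub hf _ hl0 hl]

theorem setLIntegral_rearrangement_eq (μ : Measure α) (f : α → EReal) {t : ℝ} (ht : 0 < t) :
    ∫⁻ τ in Ioo (0 : ℝ) t, rearrangement μ f (ENNReal.ofReal τ) =
      maximalFn μ f t * ENNReal.ofReal t :=
  (ENNReal.div_mul_cancel (by simpa using ht) ENNReal.ofReal_ne_top).symm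

theorem maximalFn_le_of_marcinkiewiczNorm_le (hF : IsQuasiConvex F) {l : ℝ≥0∞}
    (hfl : marcinkiewiczNorm μ F f ≤ l) {t : ℝ} (ht : 0 < t) :
    maximalFn μ f t ≤ level F t * l := by
  have h : (level F t)⁻¹ * maximalFn μ f t ≤ l := (iSup₂_le_iff.1 hfl) t ht
  rwa [ENNReal.inv_mul_le_iff (level_ne_zero hF t) (level_ne_top hF ht)] at h

theorem modular_levelYoung_le_one (hF : IsQuasiConvex F) {t : ℕ → ℝ} (ht : ∀ n, 0 < t n)
    (hf : AEMeasurable f μ) {l : ℝ≥0∞} (hl0 : l ≠ 0) (hl : l ≠ ∞)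
    (hfl : marcinkiewiczNorm μ F f ≤ l) : modular μ (levelYoung F t) f l ≤ 1 := by
  rw [levelYoung, modular_rampSum hf _ _ hl0 hl, ← tsum_two_inv_pow_succ]
  refine ENNReal.tsum_le_tsum fun n => ?_
  have hmax := maximalFn_le_of_marcinkiewiczNorm_le hF hfl (ht n)
  have hint : (∫⁻ x, ((f x).abs - level F (t n) * l) ∂μ) / l ≤
      ENNReal.ofReal (t n) * level F (t n) := by
    refine ENNReal.div_le_of_le_mul ?_
    calc ∫⁻ x, ((f x).abs - level F (t n) * l) ∂μ
        ≤ maximalFn μ f (t n) * ENNReal.ofReal (t n) :=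
          (lintegral_abs_sub_le hf ((rearrangement_le_maximalFn μ f (ht n)).trans hmax)).trans
            (setLIntegral_rearrangement_eq μ f (ht n)).le
      _ ≤ level F (t n) * l * ENNReal.ofReal (t n) := by gcongr
      _ = ENNReal.ofReal (t n) * level F (t n) * l := by ring
  calc _ ≤ (2⁻¹ : ℝ≥0∞) ^ (n + 1) / (ENNReal.ofReal (t n) * level F (t n)) *
          (ENNReal.ofReal (t n) * level F (t n)) := by gcongr
    _ ≤ _ := ENNReal.mul_le_of_le_div le_rfl

theorem marcinkiewiczEmbedsOrlicz_levelYoung (hF : IsQuasiConvex F) {t : ℕ → ℝ}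
    (ht : ∀ n, 0 < t n) : MarcinkiewiczEmbedsOrlicz μ F (levelYoung F t) := by
  refine ⟨1, one_pos, fun f hf => ?_⟩
  rw [ENNReal.coe_one, one_mul]
  -- Taking `l` strictly above the norm keeps it positive even when the norm is zero.
  refine le_of_forall_gt_imp_ge_of_dense fun l hl => ?_
  rcases eq_or_ne l ∞ with rfl | hlt
  · exact le_top
  have hl0 : 0 < l := bot_le.trans_lt hl
  exact sInf_le ⟨hl0, hlt.lt_top, modular_levelYoung_le_one hF ht hf.1 hl0.ne' hlt hl.le⟩

/-- Quantitative necessary condition for `f ∈ L^B` with `B = levelYoung F t`. -/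
theorem maximalFn_le_of_modular_levelYoung_le_one (hF : IsQuasiConvex F) {t : ℕ → ℝ}
    (ht : ∀ n, 0 < t n) (hf : AEMeasurable f μ) {l : ℝ≥0∞} (hl0 : l ≠ 0) (hl : l ≠ ∞)
    (hmod : modular μ (levelYoung F t) f l ≤ 1) (n : ℕ) :
    (level F (t n))⁻¹ * maximalFn μ f (t n) ≤ (2 ^ (n + 1) + 1) * l := by
  have ht0 : ENNReal.ofReal (t n) ≠ 0 := by simpa using ht n
  have hp0 : (2 : ℝ≥0∞) ^ (n + 1) ≠ 0 := pow_ne_zero _ two_ne_zero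
  have hpt : (2 : ℝ≥0∞) ^ (n + 1) ≠ ∞ := ENNReal.pow_ne_top ENNReal.ofNat_ne_top
  rw [levelYoung, modular_rampSum hf _ _ hl0 hl] at hmod
  have hn := (ENNReal.le_tsum n).trans hmod
  set D := ENNReal.ofReal (t n) * level F (t n) with hD
  have hD0 : D ≠ 0 := ofReal_mul_level_ne_zero hF (ht n)
  have hDt : D ≠ ∞ := ofReal_mul_level_ne_top hF (ht n)
  set I := ∫⁻ x, ((f x).abs - level F (t n) * l) ∂μ with hI
  have hcoef : (2⁻¹ : ℝ≥0∞) ^ (n + 1) / D * (I / l) = (2 ^ (n + 1) * D * l)⁻¹ * I := by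
    rw [ENNReal.mul_inv (Or.inr hl) (Or.inr hl0), ENNReal.mul_inv (Or.inr hDt) (Or.inr hD0),
      ← ENNReal.inv_pow, div_eq_mul_inv, div_eq_mul_inv]
    ring
  have hIle : I ≤ 2 ^ (n + 1) * D * l := by
    have h := hcoef ▸ hn
    rwa [ENNReal.inv_mul_le_iff (mul_ne_zero (mul_ne_zero hp0 hD0) hl0)
      (ENNReal.mul_ne_top (ENNReal.mul_ne_top hpt hDt) hl), mul_one] at h
  rw [ENNReal.inv_mul_le_iff (level_ne_zero hF _) (level_ne_top hF (ht n)),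
    ← ENNReal.mul_le_mul_iff_left ht0 ENNReal.ofReal_ne_top,
    ← setLIntegral_rearrangement_eq μ f (ht n)]
  -- The `2^(n+1)` comes from the single `n`-th term of the modular, the `+ 1` from the part of
  -- `f^*` below the level.
  calc _ ≤ I + level F (t n) * l * ENNReal.ofReal (t n) := setLIntegral_rearrangement_le hf _ _
    _ ≤ 2 ^ (n + 1) * D * l + level F (t n) * l * ENNReal.ofReal (t n) := by gcongr
    _ = _ := by rw [hD]; ring

theorem exists_sequence_of_marcinkiewiczNorm_eq_top (h : marcinkiewiczNorm μ F f = ∞) :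
    ∃ t : ℕ → ℝ, ∀ n, 0 < t n ∧ 4 ^ n < (level F (t n))⁻¹ * maximalFn μ f (t n) := by
  have hex : ∀ n : ℕ, ∃ t : ℝ, 0 < t ∧ 4 ^ n < (level F t)⁻¹ * maximalFn μ f t := fun n => by
    have hlt : (4 : ℝ≥0∞) ^ n < marcinkiewiczNorm μ F f :=
      h ▸ ENNReal.pow_lt_top ENNReal.ofNat_lt_top
    simp only [marcinkiewiczNorm, lt_iSup_iff] at hlt
    obtain ⟨t, ht, hlt⟩ := hlt
    exact ⟨t, ht, hlt⟩
  choose t ht using hex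
  exact ⟨t, ht⟩

theorem not_forall_four_pow_le {l : ℝ≥0∞} (hl : l ≠ ∞) :
    ¬ ∀ n : ℕ, (4 : ℝ≥0∞) ^ n ≤ (2 ^ (n + 1) + 1) * l := by
  intro h
  obtain ⟨n, hn⟩ := ENNReal.exists_nat_gt (ENNReal.mul_ne_top (ENNReal.ofNat_ne_top (n := 3)) hl)
  have hp0 : (2 : ℝ≥0∞) ^ n ≠ 0 := pow_ne_zero _ two_ne_zero
  have hpt : (2 : ℝ≥0∞) ^ n ≠ ∞ := ENNReal.pow_ne_top ENNReal.ofNat_ne_top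
  have hle : (2 : ℝ≥0∞) ^ n * 2 ^ n ≤ 2 ^ n * (3 * l) :=
    calc (2 : ℝ≥0∞) ^ n * 2 ^ n = 4 ^ n := by rw [← mul_pow]; norm_num
      _ ≤ (2 ^ (n + 1) + 1) * l := h n
      _ ≤ (2 ^ (n + 1) + 2 ^ n) * l := by gcongr; exact one_le_pow₀ one_le_two
      _ = 2 ^ n * (3 * l) := by ring
  have hle' : (2 : ℝ≥0∞) ^ n ≤ 3 * l := (ENNReal.mul_le_mul_iff_right hp0 hpt).1 hle
  have hnat : (n : ℝ≥0∞) ≤ 2 ^ n := by exact_mod_cast n.lt_two_pow_self.le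
  exact absurd (hn.trans_le (hnat.trans hle')) (lt_irrefl _)

theorem marcinkiewiczSpace_subset_orliczSpace {B : ℝ≥0∞ → ℝ≥0∞}
    (h : MarcinkiewiczEmbedsOrlicz μ F B) : marcinkiewiczSpace μ F ⊆ orliczSpace μ B := by
  intro f hf
  obtain ⟨C, -, hC⟩ := h
  have hlt : luxemburgNorm μ B f < ∞ :=
    (hC f hf).trans_lt (ENNReal.mul_lt_top ENNReal.coe_lt_top hf.2)
  obtain ⟨l, hl, -⟩ := sInf_lt_iff.1 hlt
  exact ⟨hf.1, l, hl⟩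

/-- A Marcinkiewicz space over any measure is the intersection of the Orlicz spaces containing it. -/
theorem marcinkiewiczSpace_eq_iInter_orliczSpace (μ : Measure α) (hF : IsQuasiConvex F) :
    marcinkiewiczSpace μ F =
      ⋂ B ∈ {B : ℝ≥0∞ → ℝ≥0∞ | IsYoung B ∧ MarcinkiewiczEmbedsOrlicz μ F B}, orliczSpace μ B := by
  refine Subset.antisymm
    (subset_iInter₂ fun B hB => marcinkiewiczSpace_subset_orliczSpace hB.2) fun f hf => ?_
  have hmem : ∀ t : ℕ → ℝ, (∀ n, 0 < t n) → f ∈ orliczSpace μ (levelYoung F t) := fun t ht =>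
    mem_iInter₂.1 hf _ ⟨isYoung_levelYoung hF ht, marcinkiewiczEmbedsOrlicz_levelYoung hF ht⟩
  -- Any positive sequence serves here; only measurability is extracted.
  have hmeas : AEMeasurable f μ := (hmem (fun _ => 1) fun _ => one_pos).1
  refine ⟨hmeas, lt_top_iff_ne_top.2 fun htop => ?_⟩
  obtain ⟨t, ht⟩ := exists_sequence_of_marcinkiewiczNorm_eq_top htop
  obtain ⟨-, l, hl0, hl, hmod⟩ := hmem t fun n => (ht n).1
  exact not_forall_four_pow_le hl.ne fun n => (ht n).2.le.trans
    (maximalFn_le_of_modular_levelYoung_le_one hF (fun n => (ht n).1) hmeas hl0.ne' hl.ne hmod n)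

end LevelYoung

end Orlicz

theorem theoremT (F : ℝ≥0∞ → ℝ≥0∞) (hF : Orlicz.IsQuasiConvex F) :
    Orlicz.marcinkiewiczSpace Orlicz.halfLine F =
      ⋂ B ∈ {B : ℝ≥0∞ → ℝ≥0∞ | Orlicz.IsYoung B ∧
        Orlicz.MarcinkiewiczEmbedsOrlicz Orlicz.halfLine F B},
        Orlicz.orliczSpace Orlicz.halfLine B :=
  Orlicz.marcinkiewiczSpace_eq_iInter_orliczSpace Orlicz.halfLine hF
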